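/- Let $d\ge 0$ be an integer. Let $\mathbb W_0$ be the Weyl $*$-algebra with $d$ degrees of freedom: the complex vector space with basis the monomials $u_\alpha v_\beta$ ($\alpha,\beta\in\mathbb R^d$), with the product and involution determined by $u_\alpha v_\beta=e^{i\alpha\cdot\beta}v_\beta u_\alpha$, $u_\alpha u_{\alpha'}=u_{\alpha+\alpha'}$, $v_\beta v_{\beta'}=v_{\beta+\beta'}$, $u_0=v_0=\mathbf 1$, $u_\alpha^*=u_{-\alpha}$, $v_\beta^*=v_{-\beta}$. Let the Weyl $C^*$-algebra $\mathbb W$ be its completion in the norm $\|a\|=\sup_\rho\|\rho(a)\|$, where $\rho$ runs over the $*$-representations of $\mathbb W_0$ by bounded operators on Hilbert spaces. States of $\mathbb W$ are the positive linear functionals $\omega$ with $\omega(\mathbf 1)=1$; pure states are the extreme points of the set of states; every set of states carries the topology induced by the weak-$*$ topology. Let $\mathcal P^\tau$ be the set of pure states $\omega$ that are translation-invariant, i.e. $\omega(v_\lambda a v_\lambda^*)=\omega(a)$ for all $\lambda\in\mathbb R^d$, $a\in\mathbb W$. Let $\mathcal P^{\tau,\beta}\subseteq\mathcal P^\tau$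 be the set of plane-wave states, i.e. those $\omega\in\mathcal P^\tau$ that are semi-regular in $\beta$: for all $\alpha,\beta\in\mathbb R^d$ the map $\mathbb R\ni s\mapsto\omega(u_\alpha v_{s\beta})$ is continuous. Let $\mathfrak b(\mathbb R^d)$ be the Bohr compactification of $\mathbb R^d$, i.e. the Pontryagin dual of the additive group $\mathbb R^d$ with the discrete topology. For $\beta\in\mathbb R^d$ let $\xi_\beta(\lambda)=\lambda(\beta)$ for $\lambda\in\mathfrak b(\mathbb R^d)$. Let $\mathfrak i:\mathbb R^d\to\mathfrak b(\mathbb R^d)$ be given by $\mathfrak i(x)(\beta)=e^{i\beta\cdot x}$, and let $\mathbb R^d_{\mathfrak b}$ be $\mathbb R^d$ with the Bohr topology, i.e. the topology induced by $\mathfrak i$. Then: 1. For every $\lambda\in\mathfrak b(\mathbb R^d)$ there is exactly one state $\omega_\lambda$ of $\mathbb W$ with $\omega_\lambda(u_\alpha v_\beta)=\delta_{\alpha,0}\,\xi_{-\beta}(\lambda)$ for all $\alpha,\beta\in\mathbb R^d$, and $\lambda\mapsto\omega_\lambda$ is a homeomorphism of $\mathfrak b(\mathbb R^d)$ onto $\mathcal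 P^\tau$. 2. For every $p\in\mathbb R^d$ there is exactly one state $\omega_p$ of $\mathbb W$ with $\omega_p(u_\alpha v_\beta)=\delta_{\alpha,0}\,e^{-ip\cdot\beta}$ for all $\alpha,\beta\in\mathbb R^d$. The map $p\mapsto\omega_p$ is a homeomorphism of $\mathbb R^d_{\mathfrak b}$ onto $\mathcal P^{\tau,\beta}$, and it is the restriction of the homeomorphism in 1, i.e. $\omega_p=\omega_{\mathfrak i(p)}$. 3. The set of path components of $\mathcal P^{\tau,\beta}$ is the singleton consisting of the class of the zero-momentum state $\omega_0$ (the state $\omega_p$ for $p=0$); in particular $\mathcal P^{\tau,\beta}$ is path-connected. -/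

import Mathlib

open scoped ComplexOrder

noncomputable section

/-! ### The Weyl `*`-algebra -/

/-- The underlying space of the Weyl `*`-algebra with `d` degrees of freedom: formal complex linear
combinations of the monomials `u_α v_β`, which are indexed by the pairs `(α, β)` of vectors of
`ℝ^d`. -/
def WeylPre (d : ℕ) : Type :=
  (EuclideanSpace ℝ (Fin d) × EuclideanSpace ℝ (Fin d)) →₀ ℂ

namespace WeylPre

variable {d : ℕ}

instance : AddCommGroup (WeylPre d) :=
  inferInstanceAs (AddCommGroup
    ((EuclideanSpace ℝ (Fin d) × EuclideanSpace ℝ (Fin d)) →₀ ℂ))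

instance : Module ℂ (WeylPre d) :=
  inferInstanceAs (Module ℂ
    ((EuclideanSpace ℝ (Fin d) × EuclideanSpace ℝ (Fin d)) →₀ ℂ))

/-- The coefficients of an element in the basis of monomials. -/
def coeff : WeylPre d ≃ₗ[ℂ]
    ((EuclideanSpace ℝ (Fin d) × EuclideanSpace ℝ (Fin d)) →₀ ℂ) :=
  LinearEquiv.refl ℂ _

/-- `c • u_α v_β`, where `z = (α, β)`. -/
def mono (z : EuclideanSpace ℝ (Fin d) × EuclideanSpace ℝ (Fin d)) (c : ℂ) : WeylPre d :=
  coeff.symm (Finsupp.single z c)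

/-- The bilinear product with
`(u_α v_β) (u_α' v_β') = exp (-i α'·β) u_{α+α'} v_{β+β'}`, which is what the Weyl relations
`u_α v_β = exp (i α·β) v_β u_α`, `u_α u_α' = u_{α+α'}`, `v_β v_β' = v_{β+β'}` impose. -/
def mulₗ : WeylPre d →ₗ[ℂ] WeylPre d →ₗ[ℂ] WeylPre d :=
  (Finsupp.linearCombination ℂ fun z =>
    (Finsupp.linearCombination ℂ fun z' =>
      (mono (z + z') (Complex.exp (-(Complex.I * (inner ℝ z'.1 z.2 : ℝ)))) : WeylPre d)) ∘ₗ
        coeff.toLinearMap) ∘ₗ coeff.toLinearMap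

instance : Mul (WeylPre d) := ⟨fun a b => mulₗ a b⟩

instance : One (WeylPre d) := ⟨mono 0 1⟩

/-- The antilinear involution with `(u_α v_β)^* = v_{-β} u_{-α} = exp (-i α·β) u_{-α} v_{-β}`. -/
instance : Star (WeylPre d) :=
  ⟨fun a => (coeff a).sum fun z c =>
    mono (-z) (star c * Complex.exp (-(Complex.I * (inner ℝ z.1 z.2 : ℝ))))⟩

lemma mul_def (a b : WeylPre d) : a * b = mulₗ a b := rfl

lemma one_def : (1 : WeylPre d) = mono 0 1 := rfl

@[simp]
lemma coeff_mono (z : EuclideanSpace ℝ (Fin d) × EuclideanSpace ℝ (Fin d)) (c : ℂ) :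
    coeff (mono z c) = Finsupp.single z c := coeff.apply_symm_apply _

lemma mono_add (z : EuclideanSpace ℝ (Fin d) × EuclideanSpace ℝ (Fin d)) (c c' : ℂ) :
    mono z (c + c') = mono z c + mono z c' := by simp [mono]

@[simp]
lemma mono_zero (z : EuclideanSpace ℝ (Fin d) × EuclideanSpace ℝ (Fin d)) :
    mono z 0 = 0 := by simp [mono]

lemma smul_mono (z : EuclideanSpace ℝ (Fin d) × EuclideanSpace ℝ (Fin d)) (c c' : ℂ) :
    c • mono z c' = mono z (c * c') := by
  rw [mono, mono, ← map_smul, Finsupp.smul_single, smul_eq_mul]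

lemma induction_mono {P : WeylPre d → Prop} (a : WeylPre d) (h0 : P 0)
    (hadd : ∀ a b, P a → P b → P (a + b)) (hm : ∀ z c, P (mono z c)) : P a := by
  have h : ∀ f, P (coeff.symm f) := fun f => by
    induction f using Finsupp.induction_linear with
    | zero => simpa using h0
    | add f g hf hg => simpa using hadd _ _ hf hg
    | single z c => exact hm z c
  simpa using h (coeff a)

lemma mono_mul_mono (z z' : EuclideanSpace ℝ (Fin d) × EuclideanSpace ℝ (Fin d)) (c c' : ℂ) :
    mono z c * mono z' c' =
      mono (z + z') (c * c' * Complex.exp (-(Complex.I * (inner ℝ z'.1 z.2 : ℝ)))) := by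
  simp [mul_def, mulₗ, smul_mono, mul_assoc]

lemma star_def (a : WeylPre d) : star a = (coeff a).sum fun z c =>
    mono (-z) (star c * Complex.exp (-(Complex.I * (inner ℝ z.1 z.2 : ℝ)))) := rfl

lemma star_mono (z : EuclideanSpace ℝ (Fin d) × EuclideanSpace ℝ (Fin d)) (c : ℂ) :
    star (mono z c) =
      mono (-z) (star c * Complex.exp (-(Complex.I * (inner ℝ z.1 z.2 : ℝ)))) := by
  simp [star_def]

protected lemma star_add' (a b : WeylPre d) : star (a + b) = star a + star b := by
  rw [star_def, star_def, star_def, map_add, Finsupp.sum_add_index']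
  · intro z; simp
  · intro z c c'; rw [star_add, add_mul, mono_add]

protected lemma star_zero' : star (0 : WeylPre d) = 0 := by simp [star_def]

protected lemma mul_add' (a b c : WeylPre d) : a * (b + c) = a * b + a * c := by
  simp [mul_def]

protected lemma add_mul' (a b c : WeylPre d) : (a + b) * c = a * c + b * c := by
  simp [mul_def]

protected lemma zero_mul' (a : WeylPre d) : 0 * a = 0 := by simp [mul_def]

protected lemma mul_zero' (a : WeylPre d) : a * 0 = 0 := by simp [mul_def]

instance : Ring (WeylPre d) where
  __ := (inferInstance : AddCommGroup (WeylPre d))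
  left_distrib := WeylPre.mul_add'
  right_distrib := WeylPre.add_mul'
  zero_mul := WeylPre.zero_mul'
  mul_zero := WeylPre.mul_zero'
  mul_assoc a b c := by
    induction a using induction_mono with
    | h0 => simp only [WeylPre.zero_mul']
    | hadd a a' h h' => simp only [WeylPre.add_mul', h, h']
    | hm z x =>
    induction b using induction_mono with
    | h0 => simp only [WeylPre.zero_mul', WeylPre.mul_zero']
    | hadd a a' h h' => simp only [WeylPre.add_mul', WeylPre.mul_add', h, h']
    | hm z' x' =>
    induction c using induction_mono with
    | h0 => simp only [WeylPre.mul_zero']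
    | hadd a a' h h' => simp only [WeylPre.mul_add', h, h']
    | hm z'' x'' =>
    simp only [mono_mul_mono, add_assoc]
    congr 1
    simp only [Prod.fst_add, Prod.snd_add, inner_add_left, inner_add_right, Complex.ofReal_add,
      mul_add, neg_add, Complex.exp_add]
    ring
  one_mul a := by
    induction a using induction_mono with
    | h0 => simp only [WeylPre.mul_zero']
    | hadd a a' h h' => simp only [WeylPre.mul_add', h, h']
    | hm z x => simp [one_def, mono_mul_mono]
  mul_one a := by
    induction a using induction_mono with
    | h0 => simp only [WeylPre.zero_mul']
    | hadd a a' h h' => simp only [WeylPre.add_mul', h, h']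
    | hm z x => simp [one_def, mono_mul_mono]

instance : Algebra ℂ (WeylPre d) :=
  Algebra.ofModule (fun r a b => by simp [mul_def]) (fun r a b => by simp [mul_def])

instance : StarRing (WeylPre d) where
  star_involutive a := by
    induction a using induction_mono with
    | h0 => simp only [WeylPre.star_zero']
    | hadd a a' h h' => simp only [WeylPre.star_add', h, h']
    | hm z x =>
      simp only [star_mono, neg_neg]
      congr 1
      simp only [star_mul', star_star, Prod.fst_neg, Prod.snd_neg, inner_neg_neg]
      rw [mul_assoc, Complex.star_def, ← Complex.exp_conj, ← Complex.exp_add]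
      simp
  star_mul a b := by
    induction a using induction_mono with
    | h0 => simp only [zero_mul, mul_zero, WeylPre.star_zero']
    | hadd a a' h h' => simp only [add_mul, mul_add, WeylPre.star_add', h, h']
    | hm z x =>
    induction b using induction_mono with
    | h0 => simp only [zero_mul, mul_zero, WeylPre.star_zero']
    | hadd a a' h h' => simp only [add_mul, mul_add, WeylPre.star_add', h, h']
    | hm z' x' =>
    simp only [mono_mul_mono, star_mono, neg_add_rev]
    congr 1
    simp only [star_mul', Complex.star_def, ← Complex.exp_conj, Prod.fst_neg, Prod.snd_neg,
      Prod.fst_add, Prod.snd_add, inner_neg_neg, inner_add_left, inner_add_right, map_neg, map_mul,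
      Complex.conj_I, Complex.conj_ofReal, Complex.ofReal_add, neg_mul, neg_neg, mul_add,
      neg_add, Complex.exp_add]
    have h1 : Complex.exp (Complex.I * (inner ℝ z'.1 z.2 : ℝ)) *
        Complex.exp (-(Complex.I * (inner ℝ z'.1 z.2 : ℝ))) = 1 := by
      rw [← Complex.exp_add]; simp
    linear_combination (starRingEnd ℂ) x * (starRingEnd ℂ) x' *
      Complex.exp (-(Complex.I * (inner ℝ z.1 z.2 : ℝ))) *
      Complex.exp (-(Complex.I * (inner ℝ z.1 z'.2 : ℝ))) *
      Complex.exp (-(Complex.I * (inner ℝ z'.1 z'.2 : ℝ))) * h1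
  star_add := WeylPre.star_add'

instance : StarModule ℂ (WeylPre d) where
  star_smul c a := by
    induction a using induction_mono with
    | h0 => simp only [smul_zero, WeylPre.star_zero']
    | hadd a a' h h' => simp only [smul_add, WeylPre.star_add', h, h']
    | hm z x => simp [smul_mono, star_mono, mul_assoc]

/-! ### The minimal regular norm -/

/-- The norms `‖ρ(a)‖` where `ρ` runs over the `*`-representations of the Weyl `*`-algebra by
bounded operators on Hilbert spaces. -/
def repNorms (a : WeylPre d) : Set ℝ :=
  {r | ∃ (H : Type) (_ : NormedAddCommGroup H) (_ : InnerProductSpace ℂ H) (_ : CompleteSpace H)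
    (ρ : WeylPre d →⋆ₐ[ℂ] (H →L[ℂ] H)), r = ‖ρ a‖}

/-- The minimal regular norm `sup_ρ ‖ρ(a)‖`. -/
def regNorm (a : WeylPre d) : ℝ := sSup (repNorms a)

lemma star_mono_mul_mono (z : EuclideanSpace ℝ (Fin d) × EuclideanSpace ℝ (Fin d)) :
    star (mono z 1) * mono z 1 = (1 : WeylPre d) := by
  rw [star_mono, mono_mul_mono, one_def, neg_add_cancel]
  simp [← Complex.exp_add]

lemma norm_rep_mono_le {H : Type} [NormedAddCommGroup H] [InnerProductSpace ℂ H]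
    [CompleteSpace H] (ρ : WeylPre d →⋆ₐ[ℂ] (H →L[ℂ] H))
    (z : EuclideanSpace ℝ (Fin d) × EuclideanSpace ℝ (Fin d)) : ‖ρ (mono z 1)‖ ≤ 1 := by
  have h : ‖ρ (mono z 1)‖ * ‖ρ (mono z 1)‖ ≤ 1 := by
    rw [← CStarRing.norm_star_mul_self, ← map_star, ← map_mul, star_mono_mul_mono, map_one]
    exact ContinuousLinearMap.norm_id_le
  nlinarith [norm_nonneg (ρ (mono z 1))]

lemma bddAbove_repNorms (a : WeylPre d) : BddAbove (repNorms a) := by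
  induction a using induction_mono with
  | h0 => exact ⟨0, by rintro r ⟨H, _, _, _, ρ, rfl⟩; simp⟩
  | hadd a b ha hb =>
    obtain ⟨A, hA⟩ := ha
    obtain ⟨B, hB⟩ := hb
    refine ⟨A + B, ?_⟩
    rintro r ⟨H, _, _, _, ρ, rfl⟩
    rw [map_add]
    exact (norm_add_le _ _).trans (add_le_add (hA ⟨H, _, _, ‹_›, ρ, rfl⟩) (hB ⟨H, _, _, ‹_›, ρ, rfl⟩))
  | hm z c =>
    refine ⟨‖c‖, ?_⟩
    rintro r ⟨H, _, _, _, ρ, rfl⟩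
    rw [← mul_one c, ← smul_mono, map_smul, norm_smul, mul_one]
    exact mul_le_of_le_one_right (norm_nonneg _) (norm_rep_mono_le ρ z)

lemma norm_rep_le {H : Type} [NormedAddCommGroup H] [InnerProductSpace ℂ H]
    [CompleteSpace H] (ρ : WeylPre d →⋆ₐ[ℂ] (H →L[ℂ] H)) (a : WeylPre d) :
    ‖ρ a‖ ≤ regNorm a :=
  le_csSup (bddAbove_repNorms a) ⟨H, _, _, ‹_›, ρ, rfl⟩

lemma regNorm_le {a : WeylPre d} {C : ℝ} (hC : 0 ≤ C)
    (h : ∀ (H : Type) [NormedAddCommGroup H] [InnerProductSpace ℂ H] [CompleteSpace H]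
      (ρ : WeylPre d →⋆ₐ[ℂ] (H →L[ℂ] H)), ‖ρ a‖ ≤ C) : regNorm a ≤ C :=
  Real.sSup_le (by rintro r ⟨H, _, _, _, ρ, rfl⟩; exact h H ρ) hC

lemma regNorm_nonneg (a : WeylPre d) : 0 ≤ regNorm a :=
  Real.sSup_nonneg (by rintro r ⟨H, _, _, _, ρ, rfl⟩; exact norm_nonneg _)

/-- The minimal regular norm as a seminorm of rings. -/
def regSeminorm (d : ℕ) : RingSeminorm (WeylPre d) where
  toFun := regNorm
  map_zero' := le_antisymm (regNorm_le le_rfl fun H _ _ _ ρ => by simp) (regNorm_nonneg 0)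
  add_le' a b := regNorm_le (add_nonneg (regNorm_nonneg a) (regNorm_nonneg b))
    fun H _ _ _ ρ => by
      rw [map_add]
      exact (norm_add_le _ _).trans (add_le_add (norm_rep_le ρ a) (norm_rep_le ρ b))
  neg' a := by
    refine le_antisymm (regNorm_le (regNorm_nonneg _) fun H _ _ _ ρ => ?_)
      (regNorm_le (regNorm_nonneg _) fun H _ _ _ ρ => ?_)
    · rw [map_neg, norm_neg]; exact norm_rep_le ρ a
    · rw [← norm_neg, ← map_neg]; exact norm_rep_le ρ (-a)
  mul_le' a b := regNorm_le (mul_nonneg (regNorm_nonneg a) (regNorm_nonneg b))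
    fun H _ _ _ ρ => by
      rw [map_mul]
      exact (norm_mul_le _ _).trans
        (mul_le_mul (norm_rep_le ρ a) (norm_rep_le ρ b) (norm_nonneg _) (regNorm_nonneg a))

instance : SeminormedRing (WeylPre d) where
  __ := (inferInstance : Ring (WeylPre d))
  __ := (regSeminorm d).toSeminormedRing

lemma norm_def (a : WeylPre d) : ‖a‖ = regNorm a := rfl

instance : NormedAlgebra ℂ (WeylPre d) where
  norm_smul_le c a := regNorm_le (mul_nonneg (norm_nonneg _) (regNorm_nonneg a))
    fun H _ _ _ ρ => by
      rw [map_smul, norm_smul]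
      exact mul_le_mul_of_nonneg_left (norm_rep_le ρ a) (norm_nonneg _)

instance : NormedStarGroup (WeylPre d) where
  norm_star_le a := regNorm_le (regNorm_nonneg a) fun H _ _ _ ρ => by
    rw [map_star, norm_star]
    exact norm_rep_le ρ a

lemma norm_mul_self_le (a : WeylPre d) : ‖a‖ * ‖a‖ ≤ ‖star a * a‖ := by
  have h : ‖a‖ ≤ Real.sqrt ‖star a * a‖ := regNorm_le (Real.sqrt_nonneg _) fun H _ _ _ ρ => by
    refine Real.le_sqrt_of_sq_le ?_
    rw [sq, ← CStarRing.norm_star_mul_self, ← map_star, ← map_mul]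
    exact norm_rep_le ρ _
  calc ‖a‖ * ‖a‖ ≤ Real.sqrt ‖star a * a‖ * Real.sqrt ‖star a * a‖ :=
        mul_self_le_mul_self (norm_nonneg _) h
    _ = ‖star a * a‖ := Real.mul_self_sqrt (norm_nonneg _)

end WeylPre

/-! ### The Weyl `C^*`-algebra -/

open UniformSpace in
/-- The Weyl `C^*`-algebra: the completion of the Weyl `*`-algebra in the minimal regular norm. -/
def Weyl (d : ℕ) : Type := Completion (WeylPre d)

namespace Weyl

open UniformSpace

variable {d : ℕ}

instance : NormedRing (Weyl d) := inferInstanceAs (NormedRing (Completion (WeylPre d)))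

instance : NormedAlgebra ℂ (Weyl d) where
  __ := (inferInstanceAs (Algebra ℂ (Completion (WeylPre d))) : Algebra ℂ (Weyl d))
  norm_smul_le c a := norm_smul_le (α := ℂ) (β := Completion (WeylPre d)) c a

instance : CompleteSpace (Weyl d) := inferInstanceAs (CompleteSpace (Completion (WeylPre d)))

/-- The canonical map of the Weyl `*`-algebra into its completion. -/
def of : WeylPre d →ₐ[ℂ] Weyl d where
  __ := (Completion.coeRingHom : WeylPre d →+* Completion (WeylPre d))
  commutes' _ := rfl

lemma norm_of (a : WeylPre d) : ‖of a‖ = ‖a‖ := Completion.norm_coe a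

lemma continuous_of : Continuous (of : WeylPre d → Weyl d) :=
  Completion.continuous_coe (WeylPre d)

lemma denseRange_of : DenseRange (of : WeylPre d → Weyl d) :=
  Completion.denseRange_coe

instance : Star (Weyl d) := ⟨Completion.map star⟩

lemma star_of (a : WeylPre d) : star (of a) = of (star a) :=
  Completion.map_coe (star_isometry (E := WeylPre d)).uniformContinuous a

lemma continuous_star' : Continuous (star : Weyl d → Weyl d) :=
  Completion.continuous_map

lemma induction_of {P : Weyl d → Prop} (a : Weyl d) (hc : IsClosed {a | P a})
    (h : ∀ a, P (of a)) : P a :=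
  Completion.induction_on a hc h

lemma induction_of₂ {P : Weyl d → Weyl d → Prop} (a b : Weyl d)
    (hc : IsClosed {x : Weyl d × Weyl d | P x.1 x.2}) (h : ∀ a b, P (of a) (of b)) : P a b :=
  Completion.induction_on₂ a b hc h

instance : StarRing (Weyl d) where
  star_involutive a := by
    induction a using induction_of with
    | hc => exact isClosed_eq (continuous_star'.comp continuous_star') continuous_id
    | h a => rw [star_of, star_of, star_star]
  star_mul a b := by
    induction a, b using induction_of₂ with
    | hc =>
      exact isClosed_eq (continuous_star'.comp (continuous_fst.mul continuous_snd))
        ((continuous_star'.comp continuous_snd).mul (continuous_star'.comp continuous_fst))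
    | h a b => rw [← map_mul, star_of, star_mul, map_mul, star_of, star_of]
  star_add a b := by
    induction a, b using induction_of₂ with
    | hc =>
      exact isClosed_eq (continuous_star'.comp (continuous_fst.add continuous_snd))
        ((continuous_star'.comp continuous_fst).add (continuous_star'.comp continuous_snd))
    | h a b => rw [← map_add, star_of, star_add, map_add, star_of, star_of]

instance : CStarAlgebra (Weyl d) where
  norm_mul_self_le a := by
    induction a using induction_of with
    | hc =>
      exact isClosed_le (continuous_norm.mul continuous_norm)
        (continuous_norm.comp (continuous_star'.mul continuous_id))
    | h a => rw [star_of, ← map_mul, norm_of, norm_of]; exact WeylPre.norm_mul_self_le a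
  star_smul c a := by
    induction a using induction_of with
    | hc =>
      exact isClosed_eq (continuous_star'.comp (continuous_const_smul c))
        (continuous_star'.const_smul (star c))
    | h a => rw [← map_smul, star_of, star_smul, map_smul, star_of]

/-- The generator `u_α`. -/
def u (α : EuclideanSpace ℝ (Fin d)) : Weyl d := of (WeylPre.mono (α, 0) 1)

/-- The generator `v_β`. -/
def v (β : EuclideanSpace ℝ (Fin d)) : Weyl d := of (WeylPre.mono (0, β) 1)

/-- The translation `τ_l(a) = v_l a v_l^*`. -/
def translation (l : EuclideanSpace ℝ (Fin d)) (a : Weyl d) : Weyl d := v l * a * star (v l)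

end Weyl

/-! ### States -/

/-- The state space of a unital `C^*`-algebra, inside the dual with the weak-`*` topology: the
positive linear functionals `ω` with `ω 1 = 1`. -/
def stateSpace (A : Type*) [CStarAlgebra A] : Set (WeakDual ℂ A) :=
  {ω | ω 1 = 1 ∧ ∀ a : A, 0 ≤ ω (star a * a)}

/-- The pure states: the extreme points of the state space. -/
def pureStates (A : Type*) [CStarAlgebra A] : Set (WeakDual ℂ A) :=
  Set.extremePoints ℝ (stateSpace A)

namespace Weyl

/-- The translation-invariant states of the Weyl `C^*`-algebra. -/
def invariantStates (d : ℕ) : Set (WeakDual ℂ (Weyl d)) :=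
  {ω | ω ∈ stateSpace (Weyl d) ∧ ∀ l a, ω (translation l a) = ω a}

/-- The translation-invariant pure states of the Weyl `C^*`-algebra. -/
def pureInvariantStates (d : ℕ) : Set (WeakDual ℂ (Weyl d)) :=
  invariantStates d ∩ pureStates (Weyl d)

/-- Semi-regularity in the parameter `β`: the maps `s ↦ ω (u_α v_{sβ})` are continuous. -/
def IsSemiregular {d : ℕ} (ω : WeakDual ℂ (Weyl d)) : Prop :=
  ∀ α β : EuclideanSpace ℝ (Fin d), Continuous fun s : ℝ => ω (u α * v (s • β))

/-- The plane-wave states: the translation-invariant pure states that are semi-regular in `β`. -/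
def planeWaveStates (d : ℕ) : Set (WeakDual ℂ (Weyl d)) :=
  {ω | ω ∈ pureInvariantStates d ∧ IsSemiregular ω}

end Weyl

/-! ### The Bohr compactification of `ℝ^d` -/

/-- The additive group `ℝ^d` (written multiplicatively) with the discrete topology. -/
def DiscreteRd (d : ℕ) : Type := Multiplicative (EuclideanSpace ℝ (Fin d))

instance (d : ℕ) : CommGroup (DiscreteRd d) :=
  inferInstanceAs (CommGroup (Multiplicative (EuclideanSpace ℝ (Fin d))))

instance (d : ℕ) : TopologicalSpace (DiscreteRd d) := ⊥

instance (d : ℕ) : DiscreteTopology (DiscreteRd d) := ⟨rfl⟩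

/-- A vector `β` of `ℝ^d` as an element of the discrete group. -/
def DiscreteRd.of {d : ℕ} : Multiplicative (EuclideanSpace ℝ (Fin d)) ≃* DiscreteRd d :=
  MulEquiv.refl _

/-- The Bohr compactification of `ℝ^d`: the Pontryagin dual of the discretization of the dual group
of `ℝ^d`, the latter being identified with `ℝ^d` itself through `β ↦ (x ↦ exp (i β·x))`. -/
abbrev BohrCompactification (d : ℕ) : Type := PontryaginDual (DiscreteRd d)

namespace BohrCompactification

variable {d : ℕ}

/-- The character `ξ_β` of the Bohr compactification, `ξ_β(l) = l(β)`. -/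
def xi (β : EuclideanSpace ℝ (Fin d)) (l : BohrCompactification d) : ℂ :=
  (l (DiscreteRd.of (Multiplicative.ofAdd β)) : Circle)

/-- The canonical map of `ℝ^d` into its Bohr compactification: `x` is sent to the character
`β ↦ exp (i β·x)`. -/
def incl (x : EuclideanSpace ℝ (Fin d)) : BohrCompactification d :=
  ({ toFun := fun β =>
        Circle.exp (inner ℝ (Multiplicative.toAdd (DiscreteRd.of.symm β)) x)
     map_one' := by simp
     map_mul' := fun β β' => by simp [inner_add_left, Circle.exp_add]
     continuous_toFun := continuous_of_discreteTopology } : DiscreteRd d →ₜ* Circle)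

end BohrCompactification

/-- `ℝ^d` endowed with the Bohr topology, which is induced by the Bohr compactification. -/
def BohrRd (d : ℕ) : Type := EuclideanSpace ℝ (Fin d)

/-- A vector of `ℝ^d` as a point of `ℝ^d` with the Bohr topology. -/
def BohrRd.of {d : ℕ} : EuclideanSpace ℝ (Fin d) ≃ BohrRd d := Equiv.refl _

instance (d : ℕ) : TopologicalSpace (BohrRd d) :=
  TopologicalSpace.induced (fun p => BohrCompactification.incl (BohrRd.of.symm p)) inferInstance

end

open scoped ComplexOrder

noncomputable section

/-! ### Characters of the Bohr compactification -/

namespace BohrCompactification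

variable {d : ℕ}

/-! Everything is governed by the numbers `ω (v β)`. If they are unimodular, each `v β` lies in the
multiplicative domain of `ω`, so `ω` is translation-invariant. The Weyl relation then kills `ω (u α
* v β)` for `α ≠ 0`, and `ω` is determined by `β ↦ ω (v β)` (`eq_bohrState`). Such an `ω` is pure
because points of the unit circle are extreme in the disc (`bohrState_mem_pureInvariantStates`).

Conversely, a pure state invariant under conjugation by a unitary is multiplicative against it
(`map_mul_of_mem_pureStates`), so for a pure invariant state `β ↦ ω (v β)` is a unimodular
character, i.e. a point of the Bohr compactification. Every point occurs, through a vector state on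
`ℓ²(ℝ^d)`.

The bijection is weak-`*` continuous from a compact space to a Hausdorff one, hence a homeomorphism.
Semi-regularity says that the character is continuous along lines, i.e. that it comes from a vector.
The Bohr topology is coarser than the Euclidean one, so Euclidean paths connect the plane-wave
states. -/

lemma xi_zero (l : BohrCompactification d) : xi 0 l = 1 := by
  simp [xi]

lemma xi_add (β β' : EuclideanSpace ℝ (Fin d)) (l : BohrCompactification d) :
    xi (β + β') l = xi β l * xi β' l := by
  simp [xi]

lemma norm_xi (β : EuclideanSpace ℝ (Fin d)) (l : BohrCompactification d) : ‖xi β l‖ = 1 :=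
  Circle.norm_coe _

lemma continuous_xi (β : EuclideanSpace ℝ (Fin d)) :
    Continuous (xi β : BohrCompactification d → ℂ) :=
  continuous_subtype_val.comp
    ((ContinuousMonoidHom.instContinuousEvalConst (A := DiscreteRd d) (B := Circle)).1
      (DiscreteRd.of (Multiplicative.ofAdd β)))

lemma ext_xi {l l' : BohrCompactification d} (h : ∀ β, xi β l = xi β l') : l = l' :=
  PontryaginDual.ext fun a => Circle.ext (h (Multiplicative.toAdd (DiscreteRd.of.symm a)))

lemma xi_incl (β x : EuclideanSpace ℝ (Fin d)) :
    xi β (incl x) = Complex.exp (Complex.I * (inner ℝ β x : ℝ)) := by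
  rw [mul_comm]
  exact Circle.coe_exp _

/-- The point of the Bohr compactification given by a unimodular multiplicative function. -/
def ofFun (f : EuclideanSpace ℝ (Fin d) → ℂ) (h0 : f 0 = 1)
    (hadd : ∀ β β', f (β + β') = f β * f β') (hn : ∀ β, ‖f β‖ = 1) : BohrCompactification d :=
  ({ toFun := fun β => ⟨f (Multiplicative.toAdd (DiscreteRd.of.symm β)),
        mem_sphere_zero_iff_norm.2 (hn _)⟩
     map_one' := Circle.ext h0
     map_mul' := fun _ _ => Circle.ext (hadd _ _)
     continuous_toFun := continuous_of_discreteTopology } : DiscreteRd d →ₜ* Circle)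

lemma xi_ofFun (f : EuclideanSpace ℝ (Fin d) → ℂ) (h0 : f 0 = 1)
    (hadd : ∀ β β', f (β + β') = f β * f β') (hn : ∀ β, ‖f β‖ = 1)
    (β : EuclideanSpace ℝ (Fin d)) : xi β (ofFun f h0 hadd hn) = f β := rfl

/-- The dual of a discrete group carries the topology of pointwise convergence: evaluation embeds it
in a product of circles. -/
lemma continuous_of_continuous_xi {X : Type*} [TopologicalSpace X]
    {f : X → BohrCompactification d} (h : ∀ β, Continuous fun x => xi β (f x)) :
    Continuous f := by
  refine (ContinuousMonoidHom.isClosedEmbedding_coe (A := DiscreteRd d)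
    (B := Circle)).isInducing.continuous_iff.2 (continuous_pi fun a => ?_)
  exact Topology.IsInducing.subtypeVal.continuous_iff.2
    (h (Multiplicative.toAdd (DiscreteRd.of.symm a)))

end BohrCompactification

/-! ### The representation attached to a point of the Bohr compactification -/

namespace WeylPre

variable {d : ℕ}

/-- The Hilbert space of square-summable functions of the momentum. -/
abbrev MomentumSpace (d : ℕ) : Type := lp (fun _ : EuclideanSpace ℝ (Fin d) => ℂ) 2

lemma memℓp_shift (c : EuclideanSpace ℝ (Fin d) → Circle) (α : EuclideanSpace ℝ (Fin d))
    (f : MomentumSpace d) : Memℓp (fun γ => (c γ : ℂ) * f (γ - α)) 2 := by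
  refine memℓp_gen ?_
  have h := (lp.memℓp f).summable (by norm_num)
  simpa [Function.comp_def, Circle.norm_coe] using (Equiv.subRight α).summable_iff.2 h

/-- The translation by `α` followed by the multiplication with the unimodular function `c`. -/
def shift (c : EuclideanSpace ℝ (Fin d) → Circle) (α : EuclideanSpace ℝ (Fin d)) :
    MomentumSpace d →ₗᵢ[ℂ] MomentumSpace d where
  toFun f := ⟨fun γ => (c γ : ℂ) * f (γ - α), memℓp_shift c α f⟩
  map_add' f g := by
    ext γ
    exact mul_add _ _ _
  map_smul' a f := by
    ext γ
    exact mul_left_comm _ _ _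
  norm_map' f := by
    have h2 : 0 < (2 : ENNReal).toReal := by norm_num
    rw [lp.norm_eq_tsum_rpow h2, lp.norm_eq_tsum_rpow h2]
    congr 1
    rw [← (Equiv.subRight α).tsum_eq fun γ => ‖f γ‖ ^ (2 : ENNReal).toReal]
    refine tsum_congr fun γ => ?_
    change ‖(c γ : ℂ) * f (γ - α)‖ ^ _ = _
    rw [norm_mul, Circle.norm_coe, one_mul]
    rfl

/-- The operator of `u_α v_β`, where `z = (α, β)`, in the momentum representation. -/
def weylOp (l : BohrCompactification d) (z : EuclideanSpace ℝ (Fin d) × EuclideanSpace ℝ (Fin d)) :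
    MomentumSpace d →L[ℂ] MomentumSpace d :=
  (shift (fun γ => l (DiscreteRd.of (Multiplicative.ofAdd (-z.2))) *
    Circle.exp (-(inner ℝ z.2 (γ - z.1)))) z.1).toContinuousLinearMap

/-- Here `v β` multiplies by `ξ_{-β}(l) exp (-i β·γ)` and `u α` translates by `α`. As `v β` acts
first, its phase is evaluated at `γ - α`. -/
lemma weylOp_apply (l : BohrCompactification d)
    (z : EuclideanSpace ℝ (Fin d) × EuclideanSpace ℝ (Fin d)) (f : MomentumSpace d)
    (γ : EuclideanSpace ℝ (Fin d)) :
    weylOp l z f γ = BohrCompactification.xi (-z.2) l *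
      Complex.exp (-(Complex.I * (inner ℝ z.2 (γ - z.1) : ℝ))) * f (γ - z.1) := by
  have : -(Complex.I * (inner ℝ z.2 (γ - z.1) : ℝ)) =
      ((-(inner ℝ z.2 (γ - z.1)) : ℝ) : ℂ) * Complex.I := by
    push_cast; ring
  rw [this, ← Circle.coe_exp, BohrCompactification.xi, ← Circle.coe_mul]
  rfl

lemma weylOp_zero (l : BohrCompactification d) : weylOp l 0 = 1 := by
  ext f γ
  rw [weylOp_apply]
  simp [BohrCompactification.xi_zero]

lemma weylOp_mul (l : BohrCompactification d)
    (z z' : EuclideanSpace ℝ (Fin d) × EuclideanSpace ℝ (Fin d)) :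
    weylOp l z * weylOp l z' =
      Complex.exp (-(Complex.I * (inner ℝ z'.1 z.2 : ℝ))) • weylOp l (z + z') := by
  ext f γ
  have h1 : (weylOp l z * weylOp l z') f γ = weylOp l z (weylOp l z' f) γ := rfl
  have h2 : (Complex.exp (-(Complex.I * (inner ℝ z'.1 z.2 : ℝ))) • weylOp l (z + z')) f γ =
    Complex.exp (-(Complex.I * (inner ℝ z'.1 z.2 : ℝ))) * weylOp l (z + z') f γ := rfl
  rw [h1, h2, weylOp_apply, weylOp_apply, weylOp_apply, Prod.fst_add, Prod.snd_add, neg_add,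
    BohrCompactification.xi_add, ← sub_sub]
  have h3 : Complex.exp (-(Complex.I * (inner ℝ z'.1 z.2 : ℝ))) *
      Complex.exp (-(Complex.I * (inner ℝ (z.2 + z'.2) (γ - z.1 - z'.1) : ℝ))) =
      Complex.exp (-(Complex.I * (inner ℝ z.2 (γ - z.1) : ℝ))) *
      Complex.exp (-(Complex.I * (inner ℝ z'.2 (γ - z.1 - z'.1) : ℝ))) := by
    rw [← Complex.exp_add, ← Complex.exp_add, inner_add_left, inner_sub_right z.2 (γ - z.1) z'.1,
      real_inner_comm z.2 z'.1]
    congr 1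
    push_cast
    ring
  linear_combination -BohrCompactification.xi (-z.2) l * BohrCompactification.xi (-z'.2) l *
    f (γ - z.1 - z'.1) * h3

/-- The adjoint of an isometry is a left inverse, and the Weyl relations provide a right inverse;
the two coincide. -/
lemma star_weylOp (l : BohrCompactification d)
    (z : EuclideanSpace ℝ (Fin d) × EuclideanSpace ℝ (Fin d)) :
    star (weylOp l z) =
      Complex.exp (-(Complex.I * (inner ℝ z.1 z.2 : ℝ))) • weylOp l (-z) := by
  have h1 : star (weylOp l z) * weylOp l z = 1 := by
    rw [ContinuousLinearMap.star_eq_adjoint]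
    exact (ContinuousLinearMap.norm_map_iff_adjoint_comp_self _).1 (LinearIsometry.norm_map _)
  have h2 : weylOp l z * (Complex.exp (-(Complex.I * (inner ℝ z.1 z.2 : ℝ))) • weylOp l (-z)) =
      1 := by
    rw [mul_smul_comm, weylOp_mul, add_neg_cancel, weylOp_zero, smul_smul, ← Complex.exp_add]
    simp
  exact left_inv_eq_right_inv h1 h2

/-- The momentum representation as a linear map. -/
def momentumRepₗ (l : BohrCompactification d) :
    WeylPre d →ₗ[ℂ] (MomentumSpace d →L[ℂ] MomentumSpace d) :=
  Finsupp.linearCombination ℂ (weylOp l) ∘ₗ coeff.toLinearMap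

lemma momentumRepₗ_mono (l : BohrCompactification d)
    (z : EuclideanSpace ℝ (Fin d) × EuclideanSpace ℝ (Fin d)) (c : ℂ) :
    momentumRepₗ l (mono z c) = c • weylOp l z := by
  simp [momentumRepₗ]

/-- The momentum representation attached to a point of the Bohr compactification. -/
def momentumRep (l : BohrCompactification d) :
    WeylPre d →⋆ₐ[ℂ] (MomentumSpace d →L[ℂ] MomentumSpace d) where
  __ := AlgHom.ofLinearMap (momentumRepₗ l)
    (by rw [one_def, momentumRepₗ_mono, weylOp_zero, one_smul])
    (fun a b => by
      induction a using induction_mono with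
      | h0 => simp only [zero_mul, map_zero]
      | hadd a a' h h' => simp only [add_mul, map_add, h, h']
      | hm z x =>
      induction b using induction_mono with
      | h0 => simp only [mul_zero, map_zero]
      | hadd a a' h h' => simp only [mul_add, map_add, h, h']
      | hm z' x' =>
      rw [mono_mul_mono, momentumRepₗ_mono, momentumRepₗ_mono, momentumRepₗ_mono,
        smul_mul_smul_comm, weylOp_mul, smul_smul])
  map_star' a := by
    change momentumRepₗ l (star a) = star (momentumRepₗ l a)
    induction a using induction_mono with
    | h0 => simp only [star_zero, map_zero]
    | hadd a a' h h' => simp only [star_add, map_add, h, h']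
    | hm z x =>
      rw [star_mono, momentumRepₗ_mono, momentumRepₗ_mono, star_smul, star_weylOp, smul_smul]

lemma momentumRep_mono (l : BohrCompactification d)
    (z : EuclideanSpace ℝ (Fin d) × EuclideanSpace ℝ (Fin d)) (c : ℂ) :
    momentumRep l (mono z c) = c • weylOp l z := momentumRepₗ_mono l z c

/-- The unit vector of momentum zero. -/
def zeroMomentum (d : ℕ) : MomentumSpace d := lp.single 2 0 1

lemma norm_zeroMomentum : ‖zeroMomentum d‖ = 1 := by
  rw [zeroMomentum, lp.norm_single (by norm_num), norm_one]

lemma inner_zeroMomentum (f : MomentumSpace d) : inner ℂ (zeroMomentum d) f = f 0 := by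
  rw [zeroMomentum, lp.inner_single_left]
  simp

/-- The vector functional of the momentum representation at momentum zero. -/
def vectorFunctional (l : BohrCompactification d) : WeylPre d →L[ℂ] ℂ :=
  LinearMap.mkContinuous
    { toFun := fun a => inner ℂ (zeroMomentum d) (momentumRep l a (zeroMomentum d))
      map_add' := fun a b => by rw [map_add, add_apply, inner_add_right]
      map_smul' := fun c a => by
        rw [map_smul, smul_apply, inner_smul_right, RingHom.id_apply, smul_eq_mul] }
    1 fun a => by
      refine (norm_inner_le_norm (𝕜 := ℂ) (zeroMomentum d)
        (momentumRep l a (zeroMomentum d))).trans ?_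
      rw [norm_zeroMomentum]
      refine mul_le_mul_of_nonneg_left ?_ zero_le_one
      refine ((momentumRep l a).le_opNorm _).trans ?_
      rw [norm_zeroMomentum, mul_one]
      -- The momentum representation is one of those over which the norm is a supremum.
      exact norm_rep_le _ a

lemma vectorFunctional_apply (l : BohrCompactification d) (a : WeylPre d) :
    vectorFunctional l a = inner ℂ (zeroMomentum d) (momentumRep l a (zeroMomentum d)) := rfl

lemma norm_vectorFunctional_le (l : BohrCompactification d) : ‖vectorFunctional l‖ ≤ 1 :=
  LinearMap.mkContinuous_norm_le _ zero_le_one _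

/-- The vector is the delta function at `0`; for `α ≠ 0` translation moves it to an orthogonal delta
function. -/
lemma vectorFunctional_mono (l : BohrCompactification d) (α β : EuclideanSpace ℝ (Fin d)) (c : ℂ) :
    vectorFunctional l (mono (α, β) c) =
      if α = 0 then c * BohrCompactification.xi (-β) l else 0 := by
  rw [vectorFunctional_apply, momentumRep_mono, inner_zeroMomentum]
  change c * weylOp l (α, β) (zeroMomentum d) 0 = _
  rw [weylOp_apply]
  split_ifs with h
  · simp [h, zeroMomentum]
  · simp [zeroMomentum, h]

lemma vectorFunctional_star_mul_self_nonneg (l : BohrCompactification d) (a : WeylPre d) :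
    0 ≤ vectorFunctional l (star a * a) := by
  rw [vectorFunctional_apply, map_mul, map_star, ContinuousLinearMap.star_eq_adjoint,
    mul_apply_eq_comp, ContinuousLinearMap.adjoint_inner_right,
    inner_self_eq_norm_sq_to_K]
  rw [← RCLike.ofReal_pow]
  exact Complex.zero_le_real.2 (sq_nonneg _)

end WeylPre

/-! ### Extension of the vector functionals to states of the completion -/

namespace Weyl

variable {d : ℕ}

lemma isUniformInducing_of : IsUniformInducing (of : WeylPre d → Weyl d) :=
  UniformSpace.Completion.isUniformInducing_coe _

/-- The inclusion of the Weyl `*`-algebra as a continuous linear map. -/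
def ofL (d : ℕ) : WeylPre d →L[ℂ] Weyl d := ⟨of.toLinearMap, continuous_of⟩

/-- The state `ω_l` attached to a point `l` of the Bohr compactification. -/
def bohrState (l : BohrCompactification d) : WeakDual ℂ (Weyl d) :=
  StrongDual.toWeakDual ((WeylPre.vectorFunctional l).extend (ofL d))

lemma bohrState_of (l : BohrCompactification d) (a : WeylPre d) :
    bohrState l (of a) = WeylPre.vectorFunctional l a :=
  ContinuousLinearMap.extend_eq _ (e := ofL d) denseRange_of isUniformInducing_of a

/-- The bound is uniform in `l`, which is what `continuous_bohrState` needs. -/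
lemma norm_bohrState_apply_le (l : BohrCompactification d) (a : Weyl d) :
    ‖bohrState l a‖ ≤ ‖a‖ := by
  induction a using induction_of with
  | hc => exact isClosed_le (bohrState l).continuous.norm continuous_norm
  | h a =>
    rw [bohrState_of, norm_of]
    simpa only [one_mul] using (WeylPre.vectorFunctional l).le_of_opNorm_le
      (WeylPre.norm_vectorFunctional_le l) a

lemma u_mul_v (α β : EuclideanSpace ℝ (Fin d)) : u α * v β = of (WeylPre.mono (α, β) 1) := by
  rw [u, v, ← map_mul, WeylPre.mono_mul_mono]
  simp

lemma bohrState_u_mul_v (l : BohrCompactification d) (α β : EuclideanSpace ℝ (Fin d)) :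
    bohrState l (u α * v β) = if α = 0 then BohrCompactification.xi (-β) l else 0 := by
  rw [u_mul_v, bohrState_of, WeylPre.vectorFunctional_mono, one_mul]

lemma bohrState_mem_stateSpace (l : BohrCompactification d) :
    bohrState l ∈ stateSpace (Weyl d) := by
  refine ⟨?_, fun a => ?_⟩
  · rw [← map_one of, bohrState_of, WeylPre.one_def]
    have := WeylPre.vectorFunctional_mono l 0 0 1
    rw [if_pos rfl, neg_zero, BohrCompactification.xi_zero, mul_one] at this
    exact this
  · induction a using induction_of with
    | hc =>
      exact isClosed_le continuous_const
        ((bohrState l).continuous.comp (continuous_star'.mul continuous_id))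
    | h a =>
      rw [star_of, ← map_mul, bohrState_of]
      exact WeylPre.vectorFunctional_star_mul_self_nonneg l a

/-- A continuous functional is determined by its values on the monomials. -/
lemma ext_u_mul_v {ω ω' : WeakDual ℂ (Weyl d)}
    (h : ∀ α β, ω (u α * v β) = ω' (u α * v β)) : ω = ω' := by
  refine DFunLike.ext _ _ fun a => ?_
  induction a using induction_of with
  | hc => exact isClosed_eq ω.continuous ω'.continuous
  | h a =>
    induction a using WeylPre.induction_mono with
    | h0 => simp only [map_zero]
    | hadd a b ha hb => simp only [map_add, ha, hb]
    | hm z c =>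
      have := h z.1 z.2
      rw [u_mul_v] at this
      rw [← mul_one c, ← WeylPre.smul_mono, map_smul, map_smul, map_smul, this]

/-- On the dense `*`-algebra the evaluation is a finite combination of characters `ξ_β`. A general
`a` gives a uniform limit of such functions, since all the states are contractive. -/
lemma continuous_bohrState :
    Continuous (bohrState : BohrCompactification d → WeakDual ℂ (Weyl d)) := by
  refine WeakDual.continuous_of_continuous_eval fun a => ?_
  have hof : ∀ b : WeylPre d, Continuous fun l => bohrState l (of b) := fun b => by
    induction b using WeylPre.induction_mono with
    | h0 => simpa only [map_zero] using continuous_const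
    | hadd a b ha hb => simp only [map_add]; exact ha.add hb
    | hm z c =>
      obtain ⟨α, β⟩ := z
      simp only [bohrState_of, WeylPre.vectorFunctional_mono]
      split_ifs
      · exact continuous_const.mul (BohrCompactification.continuous_xi _)
      · exact continuous_const
  refine continuous_of_uniform_approx_of_continuous fun s hs => ?_
  obtain ⟨ε, hε, hs⟩ := Metric.mem_uniformity_dist.1 hs
  obtain ⟨b, hb⟩ := denseRange_of.exists_dist_lt a hε
  refine ⟨fun l => bohrState l (of b), hof b, fun l => hs ?_⟩
  rw [dist_eq_norm, ← map_sub]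
  exact (norm_bohrState_apply_le l _).trans_lt (by rwa [← dist_eq_norm])

end Weyl

/-! ### States and unitaries -/

section States

variable {A : Type*} [CStarAlgebra A] {ω : WeakDual ℂ A}

/-- Polarization: reality of `ω (star b * b)` at `b = 1 + a` compares the imaginary parts, at `b = 1
+ i a` the real parts. -/
lemma map_star_of_mem_stateSpace (hω : ω ∈ stateSpace A) (a : A) :
    ω (star a) = star (ω a) := by
  have h0 := (Complex.nonneg_iff.1 (hω.2 a)).2
  have h1 := (Complex.nonneg_iff.1 (hω.2 (1 + a))).2
  have h2 := (Complex.nonneg_iff.1 (hω.2 (1 + Complex.I • a))).2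
  simp only [star_add, star_one, star_smul, add_mul, mul_add, one_mul, mul_one, smul_mul_assoc,
    mul_smul_comm, map_add, map_smul, hω.1, smul_eq_mul, Complex.add_im,
    Complex.mul_im, Complex.one_im, Complex.I_re, Complex.I_im, Complex.star_def,
    Complex.conj_re, Complex.conj_im, Complex.mul_re] at h1 h2
  apply Complex.ext
  · simp only [Complex.star_def, Complex.conj_re]; linarith
  · simp only [Complex.star_def, Complex.conj_im]; linarith

/-- The left kernel of a state. -/
lemma map_star_mul_eq_zero (hω : ω ∈ stateSpace A) {n : A} (hn : ω (star n * n) = 0) (a : A) :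
    ω (star n * a) = 0 := by
  set w := ω (star n * a) with hw
  have hw' : ω (star a * n) = star w := by
    rw [hw, ← map_star_of_mem_stateSpace hω, star_mul, star_star]
  -- Positivity at `a - s w n` is affine in `s` because the quadratic term contains `ω (star n * n)
  -- = 0`.
  have key : ∀ s : ℝ, 0 ≤ (ω (star a * a)).re - 2 * s * Complex.normSq w := fun s => by
    have h := (Complex.nonneg_iff.1 (hω.2 (a + (-(s : ℂ) * w) • n))).1
    simp only [star_add, star_smul, add_mul, mul_add, smul_mul_assoc, mul_smul_comm, map_add,
      map_smul, hn, hw', ← hw, mul_zero, smul_eq_mul, Complex.zero_re, Complex.add_re, Complex.mul_re,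
      Complex.mul_im, Complex.neg_re, Complex.neg_im, Complex.ofReal_re, Complex.ofReal_im,
      Complex.star_def, Complex.conj_re, Complex.conj_im, map_mul, map_neg,
      Complex.conj_ofReal] at h
    rw [Complex.normSq_apply]
    linarith
  by_contra h0
  have hpos := Complex.normSq_pos.2 h0
  -- This `s` makes the right-hand side equal to `-1`.
  have := key (((ω (star a * a)).re + 1) / (2 * Complex.normSq w))
  have h3 : 2 * (((ω (star a * a)).re + 1) / (2 * Complex.normSq w)) * Complex.normSq w =
    (ω (star a * a)).re + 1 := by field_simp
  linarith

/-- Positivity at `1 - star (ω v) • v` reads `0 ≤ 1 - ‖ω v‖²`. -/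
lemma norm_map_le_one_of_isometry (hω : ω ∈ stateSpace A) {v : A} (hv : star v * v = 1) :
    ‖ω v‖ ≤ 1 := by
  have h := (Complex.nonneg_iff.1 (hω.2 (1 + (-star (ω v)) • v))).1
  simp only [star_add, star_smul, add_mul, mul_add, smul_mul_assoc, mul_smul_comm, map_add,
    map_smul, star_one, one_mul, mul_one, hv, hω.1, map_star_of_mem_stateSpace hω, smul_eq_mul,
    Complex.add_re, Complex.mul_re, Complex.star_def, Complex.neg_re, Complex.neg_im,
    Complex.conj_re, Complex.conj_im, Complex.one_re, map_neg, Complex.conj_conj]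
    at h
  rw [← sq_le_one_iff₀ (norm_nonneg _), Complex.sq_norm, Complex.normSq_apply]
  linarith

/-- Equality in Cauchy–Schwarz puts `star v - star (ω v) • 1` in the left kernel of `ω`. -/
lemma map_mul_of_norm_map_eq_one (hω : ω ∈ stateSpace A) {v : A} (hv : v * star v = 1)
    (h1 : ‖ω v‖ = 1) (a : A) : ω (v * a) = ω v * ω a := by
  have hc : star (ω v) * ω v = 1 := by
    rw [Complex.star_def, ← Complex.normSq_eq_conj_mul_self, ← Complex.sq_norm, h1]
    norm_num
  have hn : ω (star (star v - star (ω v) • (1 : A)) * (star v - star (ω v) • (1 : A))) = 0 := by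
    simp only [star_sub, star_star, star_smul, star_one, sub_mul, mul_sub, hv, smul_mul_assoc,
      mul_smul_comm, one_mul, mul_one, map_sub, map_smul, hω.1, map_star_of_mem_stateSpace hω,
      smul_eq_mul]
    linear_combination -hc
  have := map_star_mul_eq_zero hω hn a
  rw [star_sub, star_star, star_smul, star_star, star_one, sub_mul, smul_mul_assoc, one_mul,
    map_sub, map_smul, smul_eq_mul] at this
  exact sub_eq_zero.1 this

/-- The phases pulled out of `v` and `star v` cancel. This yields translation invariance from
unimodular values alone. -/
lemma map_conj_of_norm_map_eq_one (hω : ω ∈ stateSpace A) {v : A} (hv : v * star v = 1)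
    (h1 : ‖ω v‖ = 1) (a : A) : ω (v * a * star v) = ω a := by
  have hc : ω v * star (ω v) = 1 := by
    rw [Complex.star_def, Complex.mul_conj, ← Complex.sq_norm, h1]
    norm_num
  have h : ω (a * star v) = star (ω v) * ω a := by
    rw [← star_star (a * star v), map_star_of_mem_stateSpace hω, star_mul, star_star,
      map_mul_of_norm_map_eq_one hω hv h1, star_mul', map_star_of_mem_stateSpace hω, star_star]
  rw [mul_assoc, map_mul_of_norm_map_eq_one hω hv h1, h, ← mul_assoc, hc, one_mul]

/-- The functional `a ↦ ω (b^* a b)`. -/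
def conjFunctional (ω : WeakDual ℂ A) (b : A) : WeakDual ℂ A :=
  StrongDual.toWeakDual ((WeakDual.toStrongDual ω).comp
    ((ContinuousLinearMap.mul ℂ A (star b)).comp ((ContinuousLinearMap.mul ℂ A).flip b)))

lemma conjFunctional_apply (ω : WeakDual ℂ A) (a b : A) :
    conjFunctional ω b a = ω (star b * (a * b)) := rfl

lemma conjFunctional_nonneg (hω : ω ∈ stateSpace A) (a b : A) :
    0 ≤ conjFunctional ω b (star a * a) := by
  have h := hω.2 (a * b)
  rwa [star_mul, mul_assoc, ← mul_assoc (star a)] at h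

lemma inv_smul_conjFunctional_mem_stateSpace (hω : ω ∈ stateSpace A) {b : A} {p : ℝ}
    (hp : 0 < p) (hb : conjFunctional ω b 1 = p) :
    p⁻¹ • conjFunctional ω b ∈ stateSpace A := by
  have happ : ∀ a, (p⁻¹ • conjFunctional ω b) a = ((p⁻¹ : ℝ) : ℂ) * conjFunctional ω b a :=
    fun a => Complex.real_smul
  refine ⟨?_, fun a => ?_⟩
  · rw [happ, hb, ← Complex.ofReal_mul, inv_mul_cancel₀ hp.ne', Complex.ofReal_one]
  · rw [happ]
    exact mul_nonneg (Complex.zero_le_real.2 (inv_nonneg.2 hp.le)) (conjFunctional_nonneg hω a b)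

/-- If a pure state is a positive combination of two vector functionals, it is proportional to
them. -/
lemma conjFunctional_eq_smul_of_mem_pureStates (hω : ω ∈ pureStates A) {b b' : A} {p p' : ℝ}
    (hp : 0 < p) (hp' : 0 < p') (hb : conjFunctional ω b 1 = p)
    (hb' : conjFunctional ω b' 1 = p')
    (hsum : ∀ a, conjFunctional ω b a + conjFunctional ω b' a = ((p + p' : ℝ) : ℂ) * ω a) (a : A) :
    conjFunctional ω b a = p * ω a := by
  have hpp : 0 < p + p' := add_pos hp hp'
  have hs := hω.1
  have hseg : ω ∈ openSegment ℝ (p⁻¹ • conjFunctional ω b) (p'⁻¹ • conjFunctional ω b') := by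
    refine ⟨p / (p + p'), p' / (p + p'), div_pos hp hpp, div_pos hp' hpp, ?_, ?_⟩
    · rw [← add_div, div_self hpp.ne']
    · refine DFunLike.ext _ _ fun x => ?_
      change (p / (p + p')) • p⁻¹ • conjFunctional ω b x +
        (p' / (p + p')) • p'⁻¹ • conjFunctional ω b' x = ω x
      rw [smul_smul, smul_smul]
      have e1 : p / (p + p') * p⁻¹ = (p + p')⁻¹ := by field_simp
      have e2 : p' / (p + p') * p'⁻¹ = (p + p')⁻¹ := by field_simp
      rw [e1, e2, ← smul_add, hsum, Complex.real_smul, ← mul_assoc, ← Complex.ofReal_mul,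
        inv_mul_cancel₀ hpp.ne', Complex.ofReal_one, one_mul]
  have h := hω.2 (inv_smul_conjFunctional_mem_stateSpace hs hp hb)
    (inv_smul_conjFunctional_mem_stateSpace hs hp' hb') hseg
  have h2 : ((p⁻¹ : ℝ) : ℂ) * conjFunctional ω b a = ω a :=
    (Complex.real_smul (x := p⁻¹) (z := conjFunctional ω b a)).symm.trans (DFunLike.congr_fun h a)
  rw [← h2, ← mul_assoc, ← Complex.ofReal_mul, mul_inv_cancel₀ hp.ne', Complex.ofReal_one, one_mul]

/-- Adding the formulas for `z` and `-z` leaves `10 * ω a`, a decomposition of `ω` to which purity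
applies. The coefficient `2` keeps the weights `5 ± 4 Re (z ω(v))` at least `1`; with `1` in its
place a weight could vanish. -/
lemma conjFunctional_two_add (ω : WeakDual ℂ A) {v : A} (hinv : ∀ a, ω (star v * (a * v)) = ω a)
    {z : ℂ} (hz : star z * z = 1) (a : A) :
    conjFunctional ω ((2 : ℂ) • 1 + z • v) a =
      5 * ω a + 2 * z * ω (a * v) + 2 * star z * ω (star v * a) := by
  rw [conjFunctional_apply]
  simp only [star_add, star_smul, star_one, add_mul, mul_add, smul_mul_assoc, mul_smul_comm,
    one_mul, mul_one, map_add, map_smul, hinv, smul_eq_mul, star_ofNat]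
  linear_combination ω a * hz

/-- A pure state that is invariant under the inner automorphism of a unitary is multiplicative
with respect to this unitary. -/
lemma map_mul_of_mem_pureStates (hω : ω ∈ pureStates A) {v : A} (hv : star v * v = 1)
    (hinv : ∀ a, ω (star v * (a * v)) = ω a) (a : A) : ω (a * v) = ω a * ω v := by
  have hs := hω.1
  have hle := norm_map_le_one_of_isometry hs hv
  have key : ∀ z : ℂ, ‖z‖ = 1 → 2 * z * ω (a * v) + 2 * star z * ω (star v * a) =
      (2 * z * ω v + 2 * star z * star (ω v)) * ω a := fun z hz1 => by
    have hz : star z * z = 1 := by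
      rw [Complex.star_def, ← Complex.normSq_eq_conj_mul_self, ← Complex.sq_norm, hz1]
      norm_num
    have hz' : star (-z) * -z = 1 := by rw [star_neg, neg_mul_neg, hz]
    have hre : |(z * ω v).re| ≤ 1 := by
      refine (Complex.abs_re_le_norm _).trans ?_
      rw [norm_mul, hz1, one_mul]
      exact hle
    obtain ⟨hre1, hre2⟩ := abs_le.1 hre
    have hconj : z * ω v + star z * star (ω v) = ((2 * (z * ω v).re : ℝ) : ℂ) := by
      rw [← star_mul', Complex.star_def, Complex.add_conj]
    have h := conjFunctional_eq_smul_of_mem_pureStates hω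
      (b := (2 : ℂ) • 1 + z • v) (b' := (2 : ℂ) • 1 + (-z) • v)
      (p := 5 + 4 * (z * ω v).re) (p' := 5 - 4 * (z * ω v).re) (by linarith) (by linarith)
      (by
        rw [conjFunctional_two_add ω hinv hz, hs.1, one_mul, mul_one, mul_one,
          map_star_of_mem_stateSpace hs]
        push_cast at hconj ⊢
        linear_combination 2 * hconj)
      (by
        rw [conjFunctional_two_add ω hinv hz', hs.1, one_mul, mul_one, mul_one,
          map_star_of_mem_stateSpace hs, star_neg]
        push_cast at hconj ⊢
        linear_combination -2 * hconj)
      (fun x => by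
        rw [conjFunctional_two_add ω hinv hz, conjFunctional_two_add ω hinv hz', star_neg]
        push_cast
        ring) a
    rw [conjFunctional_two_add ω hinv hz] at h
    push_cast at hconj h
    linear_combination h - 2 * ω a * hconj
  -- The values `z = 1` and `z = i` give the sum and the difference of the two terms, isolating `ω
  -- (a * v)`.
  have h1 := key 1 norm_one
  have h2 := key Complex.I Complex.norm_I
  have hI := Complex.I_mul_I
  simp only [star_one, Complex.star_def, Complex.conj_I] at h1 h2
  linear_combination (1 / 4) * h1 - (Complex.I / 4) * h2 +
    (1 / 2) * (ω (a * v) - ω (star v * a) - (ω v - (starRingEnd ℂ) (ω v)) * ω a) * hI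

end States

namespace Weyl

variable {d : ℕ}

/-! ### Translation-invariant states -/

lemma star_v (β : EuclideanSpace ℝ (Fin d)) : star (v β) = v (-β) := by
  rw [v, star_of, WeylPre.star_mono]
  simp [v]

lemma v_add (β β' : EuclideanSpace ℝ (Fin d)) : v (β + β') = v β * v β' := by
  simp only [v, ← map_mul, WeylPre.mono_mul_mono]
  simp

lemma u_zero : u (0 : EuclideanSpace ℝ (Fin d)) = 1 := map_one of

lemma v_zero : v (0 : EuclideanSpace ℝ (Fin d)) = 1 := map_one of

lemma star_v_mul_v (β : EuclideanSpace ℝ (Fin d)) : star (v β) * v β = 1 := by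
  rw [star_v, ← v_add, neg_add_cancel, v_zero]

lemma v_mul_star_v (β : EuclideanSpace ℝ (Fin d)) : v β * star (v β) = 1 := by
  rw [star_v, ← v_add, add_neg_cancel, v_zero]

lemma translation_u_mul_v (l α β : EuclideanSpace ℝ (Fin d)) :
    translation l (u α * v β) = Complex.exp (-(Complex.I * (inner ℝ α l : ℝ))) • (u α * v β) := by
  rw [translation, star_v, u_mul_v, v, v, ← map_mul, ← map_mul, WeylPre.mono_mul_mono,
    WeylPre.mono_mul_mono, ← map_smul, WeylPre.smul_mono]
  simp

/-- Translating by the multiple `l` of `α` with `α·l = π` multiplies the monomial by `-1`. -/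
lemma map_u_mul_v_eq_zero {ω : WeakDual ℂ (Weyl d)} (hω : ∀ l a, ω (translation l a) = ω a)
    {α : EuclideanSpace ℝ (Fin d)} (hα : α ≠ 0) (β : EuclideanSpace ℝ (Fin d)) :
    ω (u α * v β) = 0 := by
  have h := hω ((Real.pi / inner ℝ α α) • α) (u α * v β)
  rw [translation_u_mul_v, inner_smul_right, div_mul_cancel₀ _ (inner_self_ne_zero.2 hα), map_smul,
    smul_eq_mul, mul_comm Complex.I, Complex.exp_neg, Complex.exp_pi_mul_I] at h
  norm_num at h
  exact self_eq_neg.1 h.symm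

lemma bohrState_v (l : BohrCompactification d) (β : EuclideanSpace ℝ (Fin d)) :
    bohrState l (v β) = BohrCompactification.xi (-β) l := by
  have := bohrState_u_mul_v l 0 β
  rwa [u_zero, one_mul, if_pos rfl] at this

lemma norm_bohrState_v (l : BohrCompactification d) (β : EuclideanSpace ℝ (Fin d)) :
    ‖bohrState l (v β)‖ = 1 := by
  rw [bohrState_v, BohrCompactification.norm_xi]

/-- A state that agrees with `ω_l` on the generators `v_β` is equal to `ω_l`. -/
lemma eq_bohrState {ω : WeakDual ℂ (Weyl d)} (hω : ω ∈ stateSpace (Weyl d))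
    {l : BohrCompactification d} (h : ∀ β, ω (v β) = BohrCompactification.xi (-β) l) :
    ω = bohrState l := by
  refine ext_u_mul_v fun α β => ?_
  rw [bohrState_u_mul_v]
  split_ifs with hα
  · rw [hα, u_zero, one_mul, h]
  -- Invariance is forced by the unimodular values on the `v β`.
  · refine map_u_mul_v_eq_zero (fun l' a => ?_) hα β
    refine map_conj_of_norm_map_eq_one hω (v_mul_star_v l') ?_ a
    rw [h, BohrCompactification.norm_xi]

/-- In a convex decomposition, the values at `v β` decompose a point of the unit circle inside the
closed disc. By strict convexity the components agree with `bohrState l` on every `v β`, which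
determines them. -/
lemma bohrState_mem_pureInvariantStates (l : BohrCompactification d) :
    bohrState l ∈ pureInvariantStates d := by
  have hs := bohrState_mem_stateSpace l
  refine ⟨⟨hs, fun l' => map_conj_of_norm_map_eq_one hs (v_mul_star_v l') (norm_bohrState_v l l')⟩,
    hs, fun ω₁ h₁ ω₂ h₂ hseg => eq_bohrState h₁ fun β => ?_⟩
  obtain ⟨s, t, hs0, ht0, hst, hsum⟩ := hseg
  have hmem : bohrState l (v β) ∈ Set.extremePoints ℝ (Metric.closedBall (0 : ℂ) 1) := by
    rw [StrictConvexSpace.extremePoints_closedBall_eq_sphere, mem_sphere_zero_iff_norm]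
    exact norm_bohrState_v l β
  rw [← bohrState_v]
  refine hmem.2 (mem_closedBall_zero_iff.2 (norm_map_le_one_of_isometry h₁ (star_v_mul_v β)))
    (mem_closedBall_zero_iff.2 (norm_map_le_one_of_isometry h₂ (star_v_mul_v β)))
    ⟨s, t, hs0, ht0, hst, ?_⟩
  exact DFunLike.congr_fun hsum (v β)

/-- Purity makes `β ↦ ω (v β)` multiplicative. The values at `β` and `-β` have modulus at most `1`
and product `1`, so they are unimodular. -/
lemma exists_bohrState_eq {ω : WeakDual ℂ (Weyl d)} (hω : ω ∈ pureInvariantStates d) :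
    ∃ l, bohrState l = ω := by
  obtain ⟨⟨hs, hinv⟩, hpure⟩ := hω
  have hmul : ∀ β β', ω (v (β + β')) = ω (v β) * ω (v β') := fun β β' => by
    rw [v_add]
    refine map_mul_of_mem_pureStates hpure (star_v_mul_v β') (fun a => ?_) _
    rw [← hinv (-β') a, translation, ← star_v, star_star, mul_assoc]
  have h0 : ω (v 0) = 1 := by rw [v_zero, hs.1]
  have hnorm : ∀ β, ‖ω (v β)‖ = 1 := fun β => by
    have h1 := norm_map_le_one_of_isometry hs (star_v_mul_v β)
    have h2 := norm_map_le_one_of_isometry hs (star_v_mul_v (-β))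
    have h3 : ‖ω (v β)‖ * ‖ω (v (-β))‖ = 1 := by
      rw [← norm_mul, ← hmul, add_neg_cancel, h0, norm_one]
    nlinarith [norm_nonneg (ω (v β)), norm_nonneg (ω (v (-β)))]
  refine ⟨BohrCompactification.ofFun (fun β => ω (v (-β))) (by rw [neg_zero, h0])
    (fun β β' => by rw [neg_add, hmul]) (fun β => hnorm _), (eq_bohrState hs fun β => ?_).symm⟩
  rw [BohrCompactification.xi_ofFun, neg_neg]

end Weyl

/-! ### Continuous characters of the real line -/

/-- A continuous character of the real line is an exponential. -/
lemma exists_eq_circleExp (f : ℝ → Circle) (hf : Continuous f) (h0 : f 0 = 1)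
    (hadd : ∀ s t, f (s + t) = f s * f t) : ∃ x : ℝ, ∀ s, f s = Circle.exp (s * x) := by
  obtain ⟨F, ⟨hF0, hF⟩, -⟩ := Circle.isCoveringMap_exp.existsUnique_continuousMap_lifts
    (⟨f, hf⟩ : C(ℝ, Circle)) 0 0 (by simp [h0])
  have hF' : ∀ s, Circle.exp (F s) = f s := fun s => congrFun hF s
  -- Both sides, as functions of `s`, lift the same map to the covering line and agree at `s = 0`.
  have hFadd : ∀ s t, F (s + t) = F s + F t := fun s t => by
    have hc : (fun s => F (s + t)) = fun s => F s + F t :=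
      Circle.isCoveringMap_exp.eq_of_comp_eq (by fun_prop) (by fun_prop)
        (by
          funext s
          simp only [Function.comp_apply, Circle.exp_add, hF', hadd])
        0 (by simp [hF0])
    exact congrFun hc s
  let G : ℝ →L[ℝ] ℝ := (AddMonoidHom.mk' F hFadd).toRealLinearMap F.continuous
  refine ⟨F 1, fun s => ?_⟩
  have h : G (s • 1) = s • G 1 := map_smul G s 1
  rw [← hF']
  congr 1
  rwa [smul_eq_mul, smul_eq_mul, mul_one] at h

/-! ### The image of `ℝ^d` in its Bohr compactification -/

namespace BohrCompactification

variable {d : ℕ}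

/-- If `x ≠ y`, the frequency `π (x - y) / ‖x - y‖²` separates them: the two characters differ there
by the factor `exp (iπ) = -1`. -/
lemma incl_injective : Function.Injective (incl : EuclideanSpace ℝ (Fin d) → _) := by
  intro x y hxy
  have key : ∀ t : ℝ, Circle.exp (t * inner ℝ (x - y) (x - y)) = 1 := fun t => by
    have h := congrArg (xi (t • (x - y))) hxy
    rw [xi_incl, xi_incl, ← div_eq_one_iff_eq (Complex.exp_ne_zero _),
      ← Complex.exp_sub, ← mul_sub, ← Complex.ofReal_sub, ← inner_sub_right, inner_smul_left] at h
    refine Circle.ext ?_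
    rw [Circle.coe_exp, mul_comm]
    simpa using h
  by_contra hne
  have hpos : inner ℝ (x - y) (x - y) ≠ 0 := inner_self_ne_zero.2 (sub_ne_zero.2 hne)
  have h := key (Real.pi / inner ℝ (x - y) (x - y))
  rw [div_mul_cancel₀ _ hpos] at h
  have h' := congrArg (fun z : Circle => (z : ℂ)) h
  simp only [Circle.coe_exp, Complex.exp_pi_mul_I, Circle.coe_one] at h'
  norm_num at h'

lemma continuous_incl : Continuous (incl : EuclideanSpace ℝ (Fin d) → _) := by
  refine continuous_of_continuous_xi fun β => ?_
  simp only [xi_incl]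
  fun_prop

/-- A character that is continuous along all lines comes from a vector. -/
lemma exists_incl_eq (l : BohrCompactification d)
    (hl : ∀ β, Continuous fun s : ℝ => xi (s • β) l) : ∃ x, incl x = l := by
  have h : ∀ β, ∃ x : ℝ, ∀ s : ℝ,
      l (DiscreteRd.of (Multiplicative.ofAdd (s • β))) = Circle.exp (s * x) := fun β => by
    refine exists_eq_circleExp _ (Topology.IsInducing.subtypeVal.continuous_iff.2 (hl β)) ?_ ?_
    · exact Circle.ext (by simp)
    · intro s t
      refine Circle.ext ?_
      rw [add_smul]
      exact xi_add _ _ l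
  choose g hg using h
  let φ : Multiplicative (EuclideanSpace ℝ (Fin d)) →* Circle :=
    (l : DiscreteRd d →ₜ* Circle).toMonoidHom.comp (DiscreteRd.of (d := d)).toMonoidHom
  let b := EuclideanSpace.basisFun (Fin d) ℝ
  -- The coordinates are the slopes along the axes; multiplicativity over the expansion of `β` in
  -- the basis does the rest.
  refine ⟨WithLp.toLp 2 fun j => g (b j), ext_xi fun β => ?_⟩
  have hφ : φ (Multiplicative.ofAdd β) = Circle.exp (∑ j, β j * g (b j)) := by
    conv_lhs => rw [← b.sum_repr β, ofAdd_sum, map_prod]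
    have hsum : Circle.exp (∑ j, β j * g (b j)) = ∏ j, Circle.exp (β j * g (b j)) := by
      induction (Finset.univ : Finset (Fin d)) using Finset.induction_on with
      | empty => simp
      | insert j s hj ih => rw [Finset.sum_insert hj, Finset.prod_insert hj, Circle.exp_add, ih]
    rw [hsum]
    exact Finset.prod_congr rfl fun j _ => hg (b j) (β j)
  rw [xi_incl]
  change _ = (φ (Multiplicative.ofAdd β) : ℂ)
  rw [hφ, Circle.coe_exp, mul_comm]
  simp [PiLp.inner_apply, mul_comm]

end BohrCompactification

/-! ### The homeomorphisms and path-connectedness -/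

namespace Weyl

variable {d : ℕ}

/-- The homeomorphism of the Bohr compactification onto the translation-invariant pure states. -/
def bohrHomeomorph (d : ℕ) : BohrCompactification d ≃ₜ pureInvariantStates d :=
  Continuous.homeoOfEquivCompactToT2
    (f := Equiv.ofBijective
      (fun l => (⟨bohrState l, bohrState_mem_pureInvariantStates l⟩ : pureInvariantStates d))
      ⟨fun l l' h => BohrCompactification.ext_xi fun β => by
        have h' := DFunLike.congr_fun (congrArg Subtype.val h) (v (-β))
        simpa only [bohrState_v, neg_neg] using h',
      fun ω => (exists_bohrState_eq ω.2).imp fun _ h => Subtype.ext h⟩)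
    (continuous_bohrState.subtype_mk _)

lemma isEmbedding_bohrState :
    Topology.IsEmbedding (bohrState : BohrCompactification d → WeakDual ℂ (Weyl d)) :=
  Topology.IsEmbedding.subtypeVal.comp (bohrHomeomorph d).isEmbedding

/-- For `α ≠ 0` the function in question is zero, so only continuity of `l` along lines is at stake.
-/
lemma isSemiregular_bohrState_iff (l : BohrCompactification d) :
    IsSemiregular (bohrState l) ↔ ∃ x, BohrCompactification.incl x = l := by
  constructor
  · intro h
    refine BohrCompactification.exists_incl_eq l fun β => ?_
    have h' := h 0 (-β)
    simpa only [bohrState_u_mul_v, if_true, smul_neg, neg_neg] using h'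
  · rintro ⟨x, rfl⟩ α β
    simp only [bohrState_u_mul_v, BohrCompactification.xi_incl]
    split_ifs
    · fun_prop
    · exact continuous_const

/-- The plane-wave state of momentum `p`. -/
def planeWave (p : BohrRd d) : WeakDual ℂ (Weyl d) :=
  bohrState (BohrCompactification.incl (BohrRd.of.symm p))

/-- The Bohr topology is by definition induced by `incl`, so only injectivity needs an argument. -/
lemma isEmbedding_planeWave : Topology.IsEmbedding (planeWave : BohrRd d → _) :=
  isEmbedding_bohrState.comp
    ⟨⟨rfl⟩, BohrCompactification.incl_injective.comp BohrRd.of.symm.injective⟩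

lemma range_planeWave : Set.range (planeWave : BohrRd d → _) = planeWaveStates d := by
  ext ω
  constructor
  · rintro ⟨p, rfl⟩
    exact ⟨bohrState_mem_pureInvariantStates _, (isSemiregular_bohrState_iff _).2 ⟨_, rfl⟩⟩
  · rintro ⟨hω, hreg⟩
    obtain ⟨l, rfl⟩ := exists_bohrState_eq hω
    obtain ⟨x, rfl⟩ := (isSemiregular_bohrState_iff l).1 hreg
    exact ⟨BohrRd.of x, rfl⟩

/-- The homeomorphism of `ℝ^d` with the Bohr topology onto the plane-wave states. -/
def planeWaveHomeomorph (d : ℕ) : BohrRd d ≃ₜ planeWaveStates d :=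
  isEmbedding_planeWave.toHomeomorph.trans (Homeomorph.setCongr range_planeWave)

lemma coe_planeWaveHomeomorph (p : BohrRd d) :
    (planeWaveHomeomorph d p : WeakDual ℂ (Weyl d)) = planeWave p := rfl

/-- The Bohr topology is coarser than the Euclidean one, so path-connectedness passes to it. -/
lemma continuous_bohrRdOf : Continuous (BohrRd.of : EuclideanSpace ℝ (Fin d) → BohrRd d) :=
  continuous_induced_rng.2 BohrCompactification.continuous_incl

instance : PathConnectedSpace (planeWaveStates d) :=
  ((planeWaveHomeomorph d).surjective.comp BohrRd.of.surjective).pathConnectedSpace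
    ((planeWaveHomeomorph d).continuous.comp continuous_bohrRdOf)

end Weyl

end

theorem mainTheorem3 (d : ℕ) :
    ∃ (Φ : BohrCompactification d ≃ₜ Weyl.pureInvariantStates d)
      (Ψ : BohrRd d ≃ₜ Weyl.planeWaveStates d),
      -- `Φ l` is the state specified by `u_α v_β ↦ δ_{α,0} ξ_{-β}(l)`
      (∀ (l : BohrCompactification d) (ω : WeakDual ℂ (Weyl d)), ω ∈ stateSpace (Weyl d) →
        (ω = Φ l ↔ ∀ α β : EuclideanSpace ℝ (Fin d),
          ω (Weyl.u α * Weyl.v β) =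
            if α = 0 then BohrCompactification.xi (-β) l else 0)) ∧
      -- `Ψ p` is the state specified by `u_α v_β ↦ δ_{α,0} exp (-i p·β)`
      (∀ (p : EuclideanSpace ℝ (Fin d)) (ω : WeakDual ℂ (Weyl d)), ω ∈ stateSpace (Weyl d) →
        (ω = Ψ (BohrRd.of p) ↔ ∀ α β : EuclideanSpace ℝ (Fin d),
          ω (Weyl.u α * Weyl.v β) =
            if α = 0 then Complex.exp (-(Complex.I * (inner ℝ p β : ℝ))) else 0)) ∧
      -- `Ψ` is the restriction of `Φ`
      (∀ p : EuclideanSpace ℝ (Fin d),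
        (Ψ (BohrRd.of p) : WeakDual ℂ (Weyl d)) = Φ (BohrCompactification.incl p)) ∧
      -- the set of path components of the plane-wave states is the singleton of the class of `ω_0`
      (Set.univ : Set (ZerothHomotopy (Weyl.planeWaveStates d))) =
        {Quotient.mk (pathSetoid (Weyl.planeWaveStates d)) (Ψ (BohrRd.of 0))} := by
  have key : ∀ (l : BohrCompactification d) (ω : WeakDual ℂ (Weyl d)),
      ω = Weyl.bohrState l ↔ ∀ α β : EuclideanSpace ℝ (Fin d), ω (Weyl.u α * Weyl.v β) =
        if α = 0 then BohrCompactification.xi (-β) l else 0 := fun l ω => by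
    constructor
    · rintro rfl
      exact Weyl.bohrState_u_mul_v l
    · intro h
      exact Weyl.ext_u_mul_v fun α β => (h α β).trans (Weyl.bohrState_u_mul_v l α β).symm
  refine ⟨Weyl.bohrHomeomorph d, Weyl.planeWaveHomeomorph d, fun l ω _ => key l ω,
    fun p ω _ => ?_, fun p => rfl, ?_⟩
  · rw [Weyl.coe_planeWaveHomeomorph, Weyl.planeWave, key]
    simp only [Equiv.symm_apply_apply, BohrCompactification.xi_incl, inner_neg_left,
      Complex.ofReal_neg, mul_neg, real_inner_comm]
  · refine (Set.eq_univ_of_forall fun x => ?_).symm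
    have : Subsingleton (ZerothHomotopy (Weyl.planeWaveStates d)) :=
      (pathConnectedSpace_iff_zerothHomotopy.1 inferInstance).2
    exact Subsingleton.elim _ _
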